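/- Call a subset $W$ of a free group $F(x_1,\dots,x_n)$ of finite rank computably enumerable if the set of reduced words in $x_1^{\pm1},\dots,x_n^{\pm1}$ representing its elements is computably enumerable. A finitely generated group $G$ is called algorithmically finite if, for every finite tuple $(g_1,\dots,g_n)$ of elements generating $G$, every infinite computably enumerable subset $W\subseteq F(x_1,\dots,x_n)$ contains two distinct elements $u\neq v$ with the same image in $G$ under the homomorphism $x_i\mapsto g_i$. **Corollary.** There exists an infinite, residually finite, algorithmically finite group. -/

import Mathlib

/-- A set `W` of elements of the free group on `n` letters is computably enumerable if the set of
the reduced words that represent its elements is computably enumerable. -/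
def IsComputablyEnumerable {n : ℕ} (W : Set (FreeGroup (Fin n))) : Prop :=
  REPred fun L : List (Fin n × Bool) => ∃ g ∈ W, g.toWord = L

/-- `G` is algorithmically finite with respect to the tuple `x` of elements of `G`: every infinite
computably enumerable set of elements of the free group contains two distinct elements with the
same value in `G`. -/
def IsAlgorithmicallyFiniteWrt {G : Type*} [Group G] {n : ℕ} (x : Fin n → G) : Prop :=
  ∀ W : Set (FreeGroup (Fin n)), W.Infinite → IsComputablyEnumerable W →
    ∃ u ∈ W, ∃ v ∈ W, u ≠ v ∧ FreeGroup.lift x u = FreeGroup.lift x v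

/-- A group is algorithmically finite if it is finitely generated and is algorithmically finite
with respect to each of its finite generating tuples. -/
def IsAlgorithmicallyFinite (G : Type*) [Group G] : Prop :=
  Group.FG G ∧ ∀ (n : ℕ) (x : Fin n → G), Subgroup.closure (Set.range x) = ⊤ →
    IsAlgorithmicallyFiniteWrt x

/-! Only countably many sets are computably enumerable, so it suffices to build an infinite
residually finite quotient of the free group `F` of rank 3 that identifies two distinct elements in
each of countably many given infinite subsets of `F`. No effectivity of the construction is needed.
Over a finite field the powers of the augmentation ideal have finite codimension. By pigeonhole the
`i`-th set therefore contains `u ≠ v` whose difference lies in the power `i + 2`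
(`exists_sub_mem_filtration`). Imposing these differences as relators gives one relator in each
degree 2, 3, ..., few enough for the Golod–Shafarevich inequality (`golod_shafarevich`) to force the
truncated quotient algebras to have unbounded dimension. The elements of `F` congruent to 1 in every
truncation form a normal subgroup, an intersection of finite-index ones, so the quotient is
residually finite. It is infinite because its order bounds those dimensions
(`finrank_quot_trunc_le_card`). -/

/-- A ring `R` with an augmentation `ε`, whose augmentation ideal is a free right module on the
elements `y i`, together with the coordinate functions `D i`, extended to `R` as Fox derivatives. -/
structure FoxCalculus (k R ι : Type*) [Field k] [Ring R] [Algebra k R] [Fintype ι] where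
  ε : R →ₐ[k] k
  y : ι → R
  D : ι → R →ₗ[k] R
  D_mul : ∀ i a b, D i (a * b) = D i a * b + ε a • D i b
  ε_y : ∀ i, ε (y i) = 0
  D_y_self : ∀ i, D i (y i) = 1
  D_y_ne : ∀ i j, i ≠ j → D i (y j) = 0
  fundamental : ∀ a, a = algebraMap k R (ε a) + ∑ i, y i * D i a

/-! ### Fox coordinates and the powers of the augmentation ideal. -/

namespace FoxCalculus

variable {k R ι : Type*} [Field k] [Ring R] [Algebra k R] [Fintype ι] (Φ : FoxCalculus k R ι)

/-- The elements of the augmentation ideal all of whose coordinates lie in `P`. -/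
def extend (P : Submodule k R) : Submodule k R :=
  LinearMap.ker Φ.ε.toLinearMap ⊓ ⨅ i, P.comap (Φ.D i)

theorem mem_extend {P : Submodule k R} {a : R} :
    a ∈ Φ.extend P ↔ Φ.ε a = 0 ∧ ∀ i, Φ.D i a ∈ P := by
  simp [extend]

theorem extend_mono {P Q : Submodule k R} (h : P ≤ Q) : Φ.extend P ≤ Φ.extend Q := by
  intro a ha
  rw [mem_extend] at ha ⊢
  exact ⟨ha.1, fun i => h (ha.2 i)⟩

theorem D_one (i : ι) : Φ.D i 1 = 0 := by
  have h := Φ.D_mul i 1 1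
  simpa using h

/-- The coordinate map modulo `P`. -/
def coords (P : Submodule k R) : R →ₗ[k] k × (ι → R ⧸ P) :=
  Φ.ε.toLinearMap.prod (LinearMap.pi fun i => P.mkQ ∘ₗ Φ.D i)

theorem ker_coords (P : Submodule k R) : LinearMap.ker (Φ.coords P) = Φ.extend P := by
  ext a
  simp [coords, mem_extend, funext_iff]

/-- This is the freeness of the augmentation ideal: a constant plus `∑ y i * w i` has arbitrary
prescribed coordinates. It yields the exact dimension count for `extend`. -/
theorem coords_surjective (P : Submodule k R) : Function.Surjective (Φ.coords P) := by
  classical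
  rintro ⟨c, v⟩
  choose w hw using fun i => P.mkQ_surjective (v i)
  refine ⟨algebraMap k R c + ∑ i, Φ.y i * w i, ?_⟩
  have hD : ∀ i, Φ.D i (algebraMap k R c + ∑ j, Φ.y j * w j) = w i := by
    intro i
    rw [map_add, map_sum, Algebra.algebraMap_eq_smul_one, map_smul, D_one, smul_zero, zero_add,
      Finset.sum_eq_single i]
    · rw [Φ.D_mul, Φ.D_y_self, Φ.ε_y, zero_smul, add_zero, one_mul]
    · intro j _ hj
      rw [Φ.D_mul, Φ.D_y_ne i j hj.symm, Φ.ε_y, zero_smul, add_zero, zero_mul]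
    · simp
  refine Prod.ext ?_ (funext fun i => ?_)
  · simp [coords, Φ.ε_y]
  · change P.mkQ (Φ.D i _) = v i
    rw [hD, hw]

/-- The quotient by `extend P` in coordinates. -/
noncomputable def quotExtendEquiv (P : Submodule k R) :
    (R ⧸ Φ.extend P) ≃ₗ[k] k × (ι → R ⧸ P) :=
  (Submodule.quotEquivOfEq _ _ (Φ.ker_coords P).symm).trans
    ((Φ.coords P).quotKerEquivOfSurjective (Φ.coords_surjective P))

theorem finite_quot_extend (P : Submodule k R) [Module.Finite k (R ⧸ P)] :
    Module.Finite k (R ⧸ Φ.extend P) :=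
  Module.Finite.equiv (Φ.quotExtendEquiv P).symm

theorem finrank_quot_extend (P : Submodule k R) [Module.Finite k (R ⧸ P)] :
    Module.finrank k (R ⧸ Φ.extend P) = 1 + Fintype.card ι * Module.finrank k (R ⧸ P) := by
  rw [(Φ.quotExtendEquiv P).finrank_eq, Module.finrank_prod, Module.finrank_self,
    Module.finrank_pi_fintype]
  simp

/-- The powers of the augmentation ideal. -/
def filtration : ℕ → Submodule k R
  | 0 => ⊤
  | n + 1 => Φ.extend (filtration n)

theorem mem_filtration_succ {n : ℕ} {a : R} :
    a ∈ Φ.filtration (n + 1) ↔ Φ.ε a = 0 ∧ ∀ i, Φ.D i a ∈ Φ.filtration n :=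
  Φ.mem_extend

theorem filtration_succ_le (n : ℕ) : Φ.filtration (n + 1) ≤ Φ.filtration n := by
  induction n with
  | zero => exact le_top
  | succ n ih => exact Φ.extend_mono ih

theorem filtration_antitone : Antitone Φ.filtration :=
  antitone_nat_of_succ_le Φ.filtration_succ_le

theorem mul_mem_filtration_right {n : ℕ} {a : R} (ha : a ∈ Φ.filtration n) (b : R) :
    a * b ∈ Φ.filtration n := by
  induction n generalizing a with
  | zero => trivial
  | succ n ih =>
    rw [mem_filtration_succ] at ha ⊢
    refine ⟨by simp [ha.1], fun i => ?_⟩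
    rw [Φ.D_mul, ha.1, zero_smul, add_zero]
    exact ih (ha.2 i)

theorem mul_mem_filtration_left {n : ℕ} (a : R) {b : R} (hb : b ∈ Φ.filtration n) :
    a * b ∈ Φ.filtration n := by
  induction n generalizing a with
  | zero => trivial
  | succ n ih =>
    have hb' := Φ.filtration_succ_le n hb
    rw [mem_filtration_succ] at hb ⊢
    refine ⟨by simp [hb.1], fun i => ?_⟩
    rw [Φ.D_mul]
    exact add_mem (ih _ hb') (Submodule.smul_mem _ _ (hb.2 i))

theorem mul_mem_filtration_add {m n : ℕ} {a b : R} (ha : a ∈ Φ.filtration m)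
    (hb : b ∈ Φ.filtration n) : a * b ∈ Φ.filtration (m + n) := by
  induction m generalizing a with
  | zero => simpa using Φ.mul_mem_filtration_left a hb
  | succ m ih =>
    rw [mem_filtration_succ] at ha
    rw [Nat.add_right_comm, mem_filtration_succ]
    refine ⟨by simp [ha.1], fun i => ?_⟩
    rw [Φ.D_mul, ha.1, zero_smul, add_zero]
    exact ih (ha.2 i)

theorem y_mul_mem_filtration {n : ℕ} (i : ι) {a : R} (ha : a ∈ Φ.filtration n) :
    Φ.y i * a ∈ Φ.filtration (n + 1) := by
  classical
  rw [mem_filtration_succ]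
  refine ⟨by simp [Φ.ε_y], fun j => ?_⟩
  rw [Φ.D_mul, Φ.ε_y, zero_smul, add_zero]
  by_cases h : j = i
  · subst h
    rwa [Φ.D_y_self, one_mul]
  · rw [Φ.D_y_ne j i h, zero_mul]
    exact zero_mem _

instance finite_quot_filtration (n : ℕ) : Module.Finite k (R ⧸ Φ.filtration n) := by
  induction n with
  | zero =>
    have : Subsingleton (R ⧸ Φ.filtration 0) :=
      Submodule.Quotient.subsingleton_iff.mpr rfl
    infer_instance
  | succ n ih => exact Φ.finite_quot_extend _

/-! ### Truncated quotients and the Golod–Shafarevich inequality. -/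

/-- The two-sided ideal generated by a family. -/
def relIdeal (k : Type*) {R : Type*} [Field k] [Ring R] [Algebra k R] (f : ℕ → R) :
    Submodule k R :=
  Submodule.span k {x | ∃ i a b, x = a * f i * b}

section Ideal

variable (f : ℕ → R)

theorem mem_relIdeal (i : ℕ) (a b : R) : a * f i * b ∈ relIdeal k f :=
  Submodule.subset_span ⟨i, a, b, rfl⟩

theorem self_mem_relIdeal (i : ℕ) : f i ∈ relIdeal k f := by
  simpa using mem_relIdeal (k := k) f i 1 1

theorem mul_mem_relIdeal_left (a : R) {b : R} (hb : b ∈ relIdeal k f) :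
    a * b ∈ relIdeal k f := by
  have : relIdeal k f ≤ (relIdeal k f).comap (LinearMap.mulLeft k a) := by
    refine Submodule.span_le.mpr ?_
    rintro _ ⟨i, c, d, rfl⟩
    simpa [mul_assoc] using mem_relIdeal (k := k) f i (a * c) d
  exact this hb

theorem mul_mem_relIdeal_right {a : R} (ha : a ∈ relIdeal k f) (b : R) :
    a * b ∈ relIdeal k f := by
  have : relIdeal k f ≤ (relIdeal k f).comap (LinearMap.mulRight k b) := by
    refine Submodule.span_le.mpr ?_
    rintro _ ⟨i, c, d, rfl⟩
    simpa [mul_assoc] using mem_relIdeal (k := k) f i c (d * b)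
  exact this ha

/-- The ideal generated by a family and a power of the augmentation ideal. -/
def trunc (n : ℕ) : Submodule k R := relIdeal k f ⊔ Φ.filtration n

theorem mul_mem_trunc_left {n : ℕ} (a : R) {b : R} (hb : b ∈ Φ.trunc f n) :
    a * b ∈ Φ.trunc f n := by
  obtain ⟨c, hc, d, hd, rfl⟩ := Submodule.mem_sup.mp hb
  rw [mul_add]
  exact add_mem (Submodule.mem_sup_left (mul_mem_relIdeal_left f a hc))
    (Submodule.mem_sup_right (Φ.mul_mem_filtration_left a hd))

theorem mul_mem_trunc_right {n : ℕ} {a : R} (ha : a ∈ Φ.trunc f n) (b : R) :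
    a * b ∈ Φ.trunc f n := by
  obtain ⟨c, hc, d, hd, rfl⟩ := Submodule.mem_sup.mp ha
  rw [add_mul]
  exact add_mem (Submodule.mem_sup_left (mul_mem_relIdeal_right f hc b))
    (Submodule.mem_sup_right (Φ.mul_mem_filtration_right hd b))

instance finite_quot_trunc (n : ℕ) : Module.Finite k (R ⧸ Φ.trunc f n) :=
  Module.Finite.of_surjective (Submodule.factor (le_sup_right : Φ.filtration n ≤ Φ.trunc f n))
    (Submodule.factor_surjective _)

theorem extend_trunc_le (m : ℕ) : Φ.extend (Φ.trunc f m) ≤ Φ.trunc f (m + 1) := by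
  intro a ha
  rw [mem_extend] at ha
  rw [Φ.fundamental a, ha.1, map_zero, zero_add]
  refine sum_mem fun i _ => ?_
  obtain ⟨c, hc, d, hd, h⟩ := Submodule.mem_sup.mp (ha.2 i)
  rw [← h, mul_add]
  exact add_mem (Submodule.mem_sup_left (mul_mem_relIdeal_left f _ hc))
    (Submodule.mem_sup_right (Φ.y_mul_mem_filtration i hd))

theorem filtration_le_extend_trunc (m : ℕ) : Φ.filtration (m + 1) ≤ Φ.extend (Φ.trunc f m) :=
  Φ.extend_mono le_sup_right

variable {f}

/-- Shows that `f i * b` modulo `extend (trunc f m)` depends only on `b` modulo `trunc f (m - 1 -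
i)`: Fox derivatives of `f i * c` stay in the ideal when `c` does, and the filtration part has
degree `(i + 2) + (m - 1 - i) = m + 1`. -/
theorem mul_mem_extend_trunc {m i : ℕ} (hi : i < m) {b : R} (hb : b ∈ Φ.trunc f (m - 1 - i))
    (hf : ∀ i, f i ∈ Φ.filtration (i + 2)) : f i * b ∈ Φ.extend (Φ.trunc f m) := by
  obtain ⟨c, hc, d, hd, rfl⟩ := Submodule.mem_sup.mp hb
  rw [mul_add]
  refine add_mem ?_ ?_
  · have hε : Φ.ε (f i) = 0 := (Φ.mem_filtration_succ.mp (hf i)).1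
    rw [mem_extend]
    refine ⟨by simp [hε], fun j => ?_⟩
    rw [Φ.D_mul, hε, zero_smul, add_zero]
    exact Submodule.mem_sup_left (mul_mem_relIdeal_left f _ hc)
  · refine Φ.filtration_le_extend_trunc f m ?_
    have h := Φ.mul_mem_filtration_add (hf i) hd
    rwa [show i + 2 + (m - 1 - i) = m + 1 by omega] at h

/-- The **Golod–Shafarevich inequality** for a family of relators of degrees `2, 3, 4, …`. -/
theorem golod_shafarevich (hf : ∀ i, f i ∈ Φ.filtration (i + 2)) (m : ℕ) :
    1 + Fintype.card ι * Module.finrank k (R ⧸ Φ.trunc f m) ≤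
      Module.finrank k (R ⧸ Φ.trunc f (m + 1)) +
        ∑ l ∈ Finset.range m, Module.finrank k (R ⧸ Φ.trunc f l) := by
  set K := Φ.extend (Φ.trunc f m) with hK
  have : Module.Finite k (R ⧸ K) := Φ.finite_quot_extend _
  have h0 := Φ.finrank_quot_extend (Φ.trunc f m)
  rw [← hK] at h0
  -- Right multiples of the relators `f i` with `i < m` will span the image of `trunc f (m + 1)` in
  -- `R ⧸ K`; later relators already lie in `K`.
  let g : ∀ i : Fin m, (R ⧸ Φ.trunc f (m - 1 - i)) →ₗ[k] R ⧸ K := fun i =>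
    Submodule.liftQ _ (K.mkQ ∘ₗ LinearMap.mulLeft k (f i)) fun b hb => by
      simpa using Φ.mul_mem_extend_trunc i.2 hb hf
  let L : (∀ i : Fin m, R ⧸ Φ.trunc f (m - 1 - i)) →ₗ[k] R ⧸ K := LinearMap.lsum k _ k g
  have hL : Φ.trunc f (m + 1) ≤ (LinearMap.range L).comap K.mkQ := by
    have hV : Φ.filtration (m + 1) ≤ (LinearMap.range L).comap K.mkQ := by
      refine (Φ.filtration_le_extend_trunc f m).trans fun a ha => ?_
      rw [Submodule.mem_comap, Submodule.mkQ_apply, (Submodule.Quotient.mk_eq_zero K).mpr ha]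
      exact zero_mem _
    refine sup_le (Submodule.span_le.mpr ?_) hV
    rintro _ ⟨i, a, b, rfl⟩
    have hfb : f i * b ∈ (LinearMap.range L).comap K.mkQ := by
      by_cases hi : i < m
      · refine ⟨Pi.single ⟨i, hi⟩ (Submodule.Quotient.mk b), ?_⟩
        simp only [L, LinearMap.lsum_piSingle]
        rfl
      · exact hV (Φ.mul_mem_filtration_right (Φ.filtration_antitone (by omega) (hf i)) b)
    -- Modulo `K` the left factor `a` acts as the scalar `ε a`, so left multiples of relators
    -- contribute nothing new.
    have hdiff : (a - algebraMap k R (Φ.ε a)) * (f i * b) ∈ K := by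
      rw [hK, mem_extend]
      refine ⟨by simp, fun j => ?_⟩
      have h0 : Φ.ε (a - algebraMap k R (Φ.ε a)) = 0 := by simp
      rw [Φ.D_mul, h0, zero_smul, add_zero, ← mul_assoc]
      exact Submodule.mem_sup_left (mem_relIdeal f i _ b)
    have hsum : a * f i * b =
        (a - algebraMap k R (Φ.ε a)) * (f i * b) + Φ.ε a • (f i * b) := by
      rw [Algebra.smul_def]; noncomm_ring
    rw [SetLike.mem_coe, hsum]
    refine add_mem ?_ (Submodule.smul_mem _ _ hfb)
    rw [Submodule.mem_comap, Submodule.mkQ_apply, (Submodule.Quotient.mk_eq_zero K).mpr hdiff]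
    exact zero_mem _
  -- The dimension of `R ⧸ K` splits into that of `R ⧸ trunc f (m + 1)` and that of the image of
  -- `trunc f (m + 1)`, which lies in the range of `L`.
  have h1 := Submodule.finrank_quotient_add_finrank ((Φ.trunc f (m + 1)).map K.mkQ)
  rw [(Submodule.quotientQuotientEquivQuotient K _ (Φ.extend_trunc_le f m)).finrank_eq] at h1
  have h2 := Submodule.finrank_mono (Submodule.map_le_iff_le_comap.mpr hL)
  have h3 := LinearMap.finrank_range_le L
  rw [Module.finrank_pi_fintype,
    Fin.sum_univ_eq_sum_range (fun i => Module.finrank k (R ⧸ Φ.trunc f (m - 1 - i))),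
    Finset.sum_range_reflect (fun i => Module.finrank k (R ⧸ Φ.trunc f i))] at h3
  omega

/-- With `a n` the dimension, carry along `∑ l < n, a l ≤ a n`. The inequality then gives `a (n + 1)
≥ 1 + 3 a n - a n = 1 + 2 a n`, which renews both claims. -/
theorem le_finrank_quot_trunc (hι : 3 ≤ Fintype.card ι) (hf : ∀ i, f i ∈ Φ.filtration (i + 2))
    (n : ℕ) : n ≤ Module.finrank k (R ⧸ Φ.trunc f n) := by
  have key : ∀ n, n ≤ Module.finrank k (R ⧸ Φ.trunc f n) ∧
      ∑ l ∈ Finset.range n, Module.finrank k (R ⧸ Φ.trunc f l) ≤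
        Module.finrank k (R ⧸ Φ.trunc f n) := by
    intro n
    induction n with
    | zero => simp
    | succ n ih =>
      have h := Φ.golod_shafarevich hf n
      have h3 := Nat.mul_le_mul_right (Module.finrank k (R ⧸ Φ.trunc f n)) hι
      rw [Finset.sum_range_succ]
      omega
  exact (key n).1

end Ideal

end FoxCalculus

/-! ### Fox calculus of a free group. -/

namespace FoxCalculus

section FreeGroup

variable (k ι : Type*) [Field k]

/-- Induction principle for the group algebra of a free group. -/
theorem freeGroupAlgebra_induction {p : MonoidAlgebra k (FreeGroup ι) → Prop}
    (a : MonoidAlgebra k (FreeGroup ι)) (one : p 1)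
    (of : ∀ j, p (MonoidAlgebra.of k _ (FreeGroup.of j)))
    (inv : ∀ j, p (MonoidAlgebra.of k _ (FreeGroup.of j)⁻¹))
    (mul : ∀ a b, p a → p b → p (a * b)) (add : ∀ a b, p a → p b → p (a + b))
    (smul : ∀ (c : k) a, p a → p (c • a)) : p a := by
  induction a using MonoidAlgebra.induction_on with
  | of g =>
    induction g using FreeGroup.induction_on with
    | C1 => rwa [map_one]
    | of j => exact of j
    | inv_of j _ => exact inv j
    | mul g h hg hh => rw [map_mul]; exact mul _ _ hg hh
  | add a b ha hb => exact add a b ha hb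
  | smul c a ha => exact smul c a ha

/-- The augmentation of the group algebra. -/
noncomputable def augmentation : MonoidAlgebra k (FreeGroup ι) →ₐ[k] k :=
  MonoidAlgebra.lift k _ _ 1

theorem augmentation_of (g : FreeGroup ι) :
    augmentation k ι (MonoidAlgebra.of k _ g) = 1 := by
  simp [augmentation]

variable [DecidableEq ι]

/-- The matrix form of the Fox derivative with respect to `i`, on a generator. -/
noncomputable def foxUnit (i j : ι) :
    (Matrix (Fin 2) (Fin 2) (MonoidAlgebra k (FreeGroup ι)))ˣ where
  val := !![MonoidAlgebra.of k _ (FreeGroup.of j), 0; if i = j then 1 else 0, 1]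
  inv := !![MonoidAlgebra.of k _ (FreeGroup.of j)⁻¹, 0;
    if i = j then -MonoidAlgebra.of k _ (FreeGroup.of j)⁻¹ else 0, 1]
  val_inv := by
    rw [Matrix.mul_fin_two, Matrix.one_fin_two, ← map_mul]
    split_ifs <;> simp [MonoidAlgebra.one_def]
  inv_val := by
    rw [Matrix.mul_fin_two, Matrix.one_fin_two, ← map_mul]
    split_ifs <;> simp [MonoidAlgebra.one_def, MonoidAlgebra.single_mul_single]

/-- The matrix form of the Fox derivative with respect to `i`. -/
noncomputable def foxMatrix (i : ι) : MonoidAlgebra k (FreeGroup ι) →ₐ[k]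
    Matrix (Fin 2) (Fin 2) (MonoidAlgebra k (FreeGroup ι)) :=
  MonoidAlgebra.lift k _ _ ((Units.coeHom _).comp (FreeGroup.lift (foxUnit k ι i)))

theorem foxMatrix_of (i j : ι) : foxMatrix k ι i (MonoidAlgebra.of k _ (FreeGroup.of j)) =
    !![MonoidAlgebra.of k _ (FreeGroup.of j), 0; if i = j then 1 else 0, 1] := by
  rw [foxMatrix, MonoidAlgebra.lift_of]
  simp [foxUnit]

theorem foxMatrix_of_inv (i j : ι) :
    foxMatrix k ι i (MonoidAlgebra.of k _ (FreeGroup.of j)⁻¹) =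
      !![MonoidAlgebra.of k _ (FreeGroup.of j)⁻¹, 0;
        if i = j then -MonoidAlgebra.of k _ (FreeGroup.of j)⁻¹ else 0, 1] := by
  rw [foxMatrix, MonoidAlgebra.lift_of, MonoidHom.comp_apply, map_inv, FreeGroup.lift_apply_of]
  rfl

/-- The matrices are lower triangular with diagonal `a`, `ε a`, so multiplicativity of `foxMatrix`
becomes the product rule for the lower-left entry. -/
theorem foxMatrix_entries (i : ι) (a : MonoidAlgebra k (FreeGroup ι)) :
    foxMatrix k ι i a 0 0 = a ∧ foxMatrix k ι i a 0 1 = 0 ∧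
      foxMatrix k ι i a 1 1 = algebraMap k _ (augmentation k ι a) := by
  induction a using freeGroupAlgebra_induction with
  | one => simp only [map_one]; simp
  | of j => rw [foxMatrix_of, augmentation_of]; simp [MonoidAlgebra.one_def]
  | inv j => rw [foxMatrix_of_inv, augmentation_of]; simp [MonoidAlgebra.one_def]
  | mul a b ha hb => simp [Matrix.mul_apply, ha, hb]
  | add a b ha hb => simp [ha, hb]
  | smul c a ha =>
    simp only [map_smul, Matrix.smul_apply, ha, smul_zero, true_and]
    rw [smul_eq_mul, map_mul, Algebra.smul_def]

/-- The Fox derivative with respect to `i`. -/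
noncomputable def foxDerivative (i : ι) :
    MonoidAlgebra k (FreeGroup ι) →ₗ[k] MonoidAlgebra k (FreeGroup ι) :=
  (Matrix.entryLinearMap k _ 1 0) ∘ₗ (foxMatrix k ι i).toLinearMap

theorem foxDerivative_apply (i : ι) (a : MonoidAlgebra k (FreeGroup ι)) :
    foxDerivative k ι i a = foxMatrix k ι i a 1 0 := rfl

theorem foxDerivative_mul (i : ι) (a b : MonoidAlgebra k (FreeGroup ι)) :
    foxDerivative k ι i (a * b) =
      foxDerivative k ι i a * b + augmentation k ι a • foxDerivative k ι i b := by
  simp [foxDerivative_apply, Matrix.mul_apply, foxMatrix_entries, Algebra.smul_def]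

theorem foxDerivative_one (i : ι) : foxDerivative k ι i 1 = 0 := by
  simp [foxDerivative_apply]

theorem foxDerivative_of (i j : ι) :
    foxDerivative k ι i (MonoidAlgebra.of k _ (FreeGroup.of j)) = if i = j then 1 else 0 := by
  rw [foxDerivative_apply, foxMatrix_of]
  simp

theorem foxDerivative_of_inv (i j : ι) :
    foxDerivative k ι i (MonoidAlgebra.of k _ (FreeGroup.of j)⁻¹) =
      if i = j then -MonoidAlgebra.of k _ (FreeGroup.of j)⁻¹ else 0 := by
  rw [foxDerivative_apply, foxMatrix_of_inv]
  rfl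

theorem fox_fundamental [Fintype ι] (a : MonoidAlgebra k (FreeGroup ι)) :
    a = algebraMap k _ (augmentation k ι a) +
      ∑ i, (MonoidAlgebra.of k _ (FreeGroup.of i) - 1) * foxDerivative k ι i a := by
  induction a using freeGroupAlgebra_induction with
  | one => simp only [foxDerivative_one, map_one, mul_zero, Finset.sum_const_zero, add_zero]
  | of j =>
    rw [augmentation_of]
    simp only [foxDerivative_of, mul_ite, mul_zero, Finset.sum_ite_eq', Finset.mem_univ,
      if_true, mul_one, map_one, add_sub_cancel]
  | inv j =>
    rw [augmentation_of]
    simp only [foxDerivative_of_inv, mul_ite, mul_zero, Finset.sum_ite_eq', Finset.mem_univ,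
      if_true]
    rw [mul_neg, sub_mul, ← map_mul, mul_inv_cancel, map_one, map_one,
      one_mul]
    abel
  | mul a b ha hb =>
    simp only [foxDerivative_mul, mul_add, Finset.sum_add_distrib, map_mul]
    simp only [← mul_assoc, ← Finset.sum_mul, mul_smul_comm, ← Finset.smul_sum]
    rw [← sub_eq_iff_eq_add'.mpr ha, ← sub_eq_iff_eq_add'.mpr hb, Algebra.smul_def]
    noncomm_ring
  | add a b ha hb =>
    simp only [map_add, mul_add, Finset.sum_add_distrib]
    nth_rewrite 1 [ha, hb]
    abel
  | smul c a ha =>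
    simp only [map_smul, mul_smul_comm, ← Finset.smul_sum]
    nth_rewrite 1 [ha]
    simp [Algebra.smul_def, mul_add]

/-- The Fox calculus of a free group. -/
noncomputable def freeGroup [Fintype ι] :
    FoxCalculus k (MonoidAlgebra k (FreeGroup ι)) ι where
  ε := augmentation k ι
  y i := MonoidAlgebra.of k _ (FreeGroup.of i) - 1
  D := foxDerivative k ι
  D_mul := foxDerivative_mul k ι
  ε_y i := by rw [map_sub, augmentation_of, map_one, sub_self]
  D_y_self i := by rw [map_sub, foxDerivative_of, foxDerivative_one, if_pos rfl, sub_zero]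
  D_y_ne i j h := by rw [map_sub, foxDerivative_of, foxDerivative_one, if_neg h, sub_zero]
  fundamental := fox_fundamental k ι

end FreeGroup

/-! ### The group quotient: residual finiteness and infinitude. -/

section Quotient

variable {k F ι : Type*} [Field k] [Group F] [Fintype ι]
  (Φ : FoxCalculus k (MonoidAlgebra k F) ι) (f : ℕ → MonoidAlgebra k F)

/-- The group elements congruent to `1` modulo `trunc f n`. -/
def truncSubgroup (n : ℕ) : Subgroup F where
  carrier := {g | MonoidAlgebra.of k F g - 1 ∈ Φ.trunc f n}
  one_mem' := by rw [Set.mem_ofPred_eq, map_one, sub_self]; exact zero_mem _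
  mul_mem' {g h} hg hh := by
    have : MonoidAlgebra.of k F (g * h) - 1 =
        MonoidAlgebra.of k F g * (MonoidAlgebra.of k F h - 1) + (MonoidAlgebra.of k F g - 1) := by
      rw [map_mul]; noncomm_ring
    rw [Set.mem_ofPred_eq, this]
    exact add_mem (Φ.mul_mem_trunc_left f _ hh) hg
  inv_mem' {g} hg := by
    have : MonoidAlgebra.of k F g⁻¹ - 1 =
        -(MonoidAlgebra.of k F g⁻¹ * (MonoidAlgebra.of k F g - 1)) := by
      rw [mul_sub, ← map_mul, inv_mul_cancel, map_one]; noncomm_ring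
    rw [Set.mem_ofPred_eq, this]
    exact neg_mem (Φ.mul_mem_trunc_left f _ hg)

theorem mem_truncSubgroup {n : ℕ} {g : F} :
    g ∈ Φ.truncSubgroup f n ↔ MonoidAlgebra.of k F g - 1 ∈ Φ.trunc f n := Iff.rfl

theorem inv_mul_mem_truncSubgroup {n : ℕ} {g h : F} : g⁻¹ * h ∈ Φ.truncSubgroup f n ↔
    MonoidAlgebra.of k F g - MonoidAlgebra.of k F h ∈ Φ.trunc f n := by
  rw [mem_truncSubgroup, ← neg_mem_iff, neg_sub]
  constructor <;> intro H
  · have H' := Φ.mul_mem_trunc_left f (MonoidAlgebra.of k F g) H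
    rwa [mul_sub, ← map_mul, mul_inv_cancel_left, mul_one] at H'
  · have H' := Φ.mul_mem_trunc_left f (MonoidAlgebra.of k F g⁻¹) H
    rwa [mul_sub, ← map_mul, ← map_mul, inv_mul_cancel, map_one] at H'

instance truncSubgroup_normal (n : ℕ) : (Φ.truncSubgroup f n).Normal where
  conj_mem g hg h := by
    have : MonoidAlgebra.of k F (h * g * h⁻¹) - 1 =
        MonoidAlgebra.of k F h * (MonoidAlgebra.of k F g - 1) * MonoidAlgebra.of k F h⁻¹ := by
      rw [mul_sub, sub_mul, mul_one, ← map_mul, ← map_mul, ← map_mul, mul_inv_cancel, map_one]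
    rw [mem_truncSubgroup, this]
    exact Φ.mul_mem_trunc_right f (Φ.mul_mem_trunc_left f _ hg) _

instance truncSubgroup_finiteIndex [Finite k] (n : ℕ) : (Φ.truncSubgroup f n).FiniteIndex := by
  have : Finite (MonoidAlgebra k F ⧸ Φ.trunc f n) := Module.finite_of_finite k
  have : Finite (F ⧸ Φ.truncSubgroup f n) := by
    refine Finite.of_injective (β := MonoidAlgebra k F ⧸ Φ.trunc f n)
      (Quotient.lift (fun g => Submodule.Quotient.mk (MonoidAlgebra.of k F g)) ?_) ?_
    · intro g h H
      exact (Submodule.Quotient.eq _).mpr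
        ((Φ.inv_mul_mem_truncSubgroup f).mp (QuotientGroup.leftRel_apply.mp H))
    · rintro ⟨g⟩ ⟨h⟩ H
      exact Quotient.sound (QuotientGroup.leftRel_apply.mpr
        ((Φ.inv_mul_mem_truncSubgroup f).mpr ((Submodule.Quotient.eq _).mp H)))
  exact Subgroup.finiteIndex_of_finite_quotient

/-- The kernel of the largest quotient of `F` that is residually a quotient by `truncSubgroup`. -/
def residual : Subgroup F := ⨅ n, Φ.truncSubgroup f n

instance residual_normal : (Φ.residual f).Normal :=
  Subgroup.normal_iInf_normal fun n => Φ.truncSubgroup_normal f n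

theorem residuallyFinite_quot_residual [Finite k] :
    Group.ResiduallyFinite (F ⧸ Φ.residual f) := by
  rw [Group.residuallyFinite_iff_forall_finiteIndex]
  intro g hg
  obtain ⟨g, rfl⟩ := QuotientGroup.mk_surjective g
  refine (QuotientGroup.eq_one_iff g).mpr (Subgroup.mem_iInf.mpr fun n => ?_)
  have hle : Φ.residual f ≤ Φ.truncSubgroup f n := iInf_le _ n
  have hcomap : ((Φ.truncSubgroup f n).map (QuotientGroup.mk' (Φ.residual f))).comap
      (QuotientGroup.mk' (Φ.residual f)) = Φ.truncSubgroup f n := by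
    rw [Subgroup.comap_map_eq, QuotientGroup.ker_mk', sup_eq_left.mpr hle]
  have : ((Φ.truncSubgroup f n).map (QuotientGroup.mk' (Φ.residual f))).FiniteIndex := by
    constructor
    rw [← Subgroup.index_comap_of_surjective _ (QuotientGroup.mk'_surjective _), hcomap]
    exact (Φ.truncSubgroup_finiteIndex f n).index_ne_zero
  rw [← hcomap]
  exact hg ((Φ.truncSubgroup f n).map (QuotientGroup.mk' (Φ.residual f)))

/-- Group elements span the truncated algebra, and their classes there depend only on their cosets
modulo `residual`. -/
theorem finrank_quot_trunc_le_card [Finite (F ⧸ Φ.residual f)] (n : ℕ) :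
    Module.finrank k (MonoidAlgebra k F ⧸ Φ.trunc f n) ≤ Nat.card (F ⧸ Φ.residual f) := by
  have := Fintype.ofFinite (F ⧸ Φ.residual f)
  let b : F ⧸ Φ.residual f → MonoidAlgebra k F ⧸ Φ.trunc f n :=
    fun g => Submodule.Quotient.mk (MonoidAlgebra.of k F g.out)
  have hb : ∀ g : F, b g = Submodule.Quotient.mk (MonoidAlgebra.of k F g) := by
    intro g
    refine (Submodule.Quotient.eq _).mpr ((Φ.inv_mul_mem_truncSubgroup f).mp ?_)
    exact (iInf_le _ n : Φ.residual f ≤ _) (QuotientGroup.eq.mp (QuotientGroup.out_eq' _))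
  have htop : ⊤ ≤ (Submodule.span k (Set.range b)).comap (Φ.trunc f n).mkQ := by
    rintro a -
    induction a using MonoidAlgebra.induction_on with
    | of g => exact Submodule.subset_span ⟨g, hb g⟩
    | add a b ha hb => exact add_mem ha hb
    | smul c a ha => exact Submodule.smul_mem _ c ha
  have hspan : Submodule.span k (Set.range b) = ⊤ := by
    refine top_le_iff.mp fun x _ => ?_
    obtain ⟨a, rfl⟩ := Submodule.mkQ_surjective _ x
    exact htop trivial
  rw [← finrank_top, ← hspan, Nat.card_eq_fintype_card]
  exact finrank_range_le_card b

theorem infinite_quot_residual (hι : 3 ≤ Fintype.card ι)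
    (hf : ∀ i, f i ∈ Φ.filtration (i + 2)) : Infinite (F ⧸ Φ.residual f) := by
  by_contra h
  rw [not_infinite_iff_finite] at h
  have h1 := Φ.finrank_quot_trunc_le_card f (Nat.card (F ⧸ Φ.residual f) + 1)
  have h2 := Φ.le_finrank_quot_trunc hι hf (Nat.card (F ⧸ Φ.residual f) + 1)
  omega

theorem exists_sub_mem_filtration [Finite k] {S : Set F} (hS : S.Infinite) (n : ℕ) :
    ∃ u ∈ S, ∃ v ∈ S, u ≠ v ∧
      MonoidAlgebra.of k F u - MonoidAlgebra.of k F v ∈ Φ.filtration n := by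
  have : Finite (MonoidAlgebra k F ⧸ Φ.filtration n) := Module.finite_of_finite k
  obtain ⟨u, hu, v, hv, huv, h⟩ := hS.exists_ne_map_eq_of_mapsTo
    (f := fun g => (Submodule.Quotient.mk (MonoidAlgebra.of k F g) :
      MonoidAlgebra k F ⧸ Φ.filtration n)) (Set.mapsTo_univ _ _) Set.finite_univ
  exact ⟨u, hu, v, hv, huv, (Submodule.Quotient.eq _).mp h⟩

/-- An infinite residually finite quotient in which each of countably many given infinite sets
has two distinct elements identified. -/
theorem exists_normal_identifying {k F ι : Type*} [Field k] [Finite k] [Group F] [Fintype ι]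
    (Φ : FoxCalculus k (MonoidAlgebra k F) ι) (hι : 3 ≤ Fintype.card ι) (S : ℕ → Set F)
    (hS : ∀ i, (S i).Infinite) :
    ∃ (N : Subgroup F) (_ : N.Normal), Infinite (F ⧸ N) ∧ Group.ResiduallyFinite (F ⧸ N) ∧
      ∀ i, ∃ u ∈ S i, ∃ v ∈ S i, u ≠ v ∧ (u : F ⧸ N) = v := by
  choose u hu v hv huv h using fun i => Φ.exists_sub_mem_filtration (hS i) (i + 2)
  refine ⟨Φ.residual fun i => MonoidAlgebra.of k F (u i) - MonoidAlgebra.of k F (v i),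
    inferInstance, Φ.infinite_quot_residual _ hι h, Φ.residuallyFinite_quot_residual _,
    fun i => ⟨u i, hu i, v i, hv i, huv i, QuotientGroup.eq.mpr (Subgroup.mem_iInf.mpr fun n =>
      (Φ.inv_mul_mem_truncSubgroup _).mpr (Submodule.mem_sup_left ?_))⟩⟩
  exact self_mem_relIdeal (fun i => MonoidAlgebra.of k F (u i) - MonoidAlgebra.of k F (v i)) i

end Quotient

end FoxCalculus

/-! ### Countability of the enumerable sets, and the conclusion. -/

theorem countable_setOf_rePred (α : Type*) [Primcodable α] :
    {p : α → Prop | REPred p}.Countable := by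
  -- A predicate is recovered from the domain of its semidecision procedure, and programs are
  -- countable in number.
  have hinj : Function.Injective fun p : {p : α → Prop // REPred p} =>
      (⟨_, p.2⟩ : {g : ℕ →. ℕ // Nat.Partrec g}) := by
    rintro ⟨p, hp⟩ ⟨q, hq⟩ h
    refine Subtype.ext (funext fun a => propext ?_)
    have h' := congrArg Part.Dom (congrFun (Subtype.ext_iff.mp h) (Encodable.encode a))
    simpa [Part.assert] using h'
  have : Countable {g : ℕ →. ℕ // Nat.Partrec g} := by
    refine Function.Surjective.countable (α := Nat.Partrec.Code)
      (f := fun c => ⟨c.eval, Nat.Partrec.Code.exists_code.mpr ⟨c, rfl⟩⟩) ?_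
    rintro ⟨g, hg⟩
    obtain ⟨c, hc⟩ := Nat.Partrec.Code.exists_code.mp hg
    exact ⟨c, Subtype.ext hc⟩
  exact hinj.countable

theorem countable_setOf_isComputablyEnumerable (n : ℕ) :
    {W : Set (FreeGroup (Fin n)) | IsComputablyEnumerable W}.Countable := by
  refine ((countable_setOf_rePred (List (Fin n × Bool))).preimage_of_injOn
    (f := fun (W : Set (FreeGroup (Fin n))) L => ∃ g ∈ W, g.toWord = L) ?_).mono fun W hW => hW
  intro W _ W' _ h
  ext g
  have h' := congrFun h g.toWord
  simpa [FreeGroup.toWord_inj] using h'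

/-- Transporting enumerable sets into `F` along all tuples handles every finite tuple of the
quotient at once. -/
theorem countable_setOf_image_lift (F : Type*) [Group F] [Countable F] :
    {S : Set F | ∃ (n : ℕ) (x : Fin n → F) (W : Set (FreeGroup (Fin n))),
      IsComputablyEnumerable W ∧ FreeGroup.lift x '' W = S}.Countable := by
  have h : ∀ n (x : Fin n → F), {S : Set F | ∃ W : Set (FreeGroup (Fin n)),
      IsComputablyEnumerable W ∧ FreeGroup.lift x '' W = S}.Countable := fun n x =>
    (countable_setOf_isComputablyEnumerable n).image _
  refine (Set.countable_iUnion fun n => Set.countable_iUnion fun x => h n x).mono ?_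
  rintro S ⟨n, x, W, hW⟩
  simp only [Set.mem_iUnion]
  exact ⟨n, x, W, hW⟩

theorem mainTheorem7 :
    ∃ (G : Type) (_ : Group G),
      Infinite G ∧ Group.ResiduallyFinite G ∧ IsAlgorithmicallyFinite G := by
  let F := FreeGroup (Fin 3)
  have : Infinite F := inferInstanceAs (Infinite (FreeGroup (Fin 3)))
  have : Countable F := FreeGroup.toWord_injective.countable
  -- `Set.univ` is inserted only to have a nonempty family, hence an enumeration by `ℕ`.
  obtain ⟨S, hS⟩ := (((countable_setOf_image_lift F).mono
    (Set.inter_subset_left (t := {S | S.Infinite}))).insert Set.univ).exists_eq_range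
      (Set.insert_nonempty _ _)
  have hSinf : ∀ i, (S i).Infinite := by
    intro i
    have hi : S i ∈ Set.range S := ⟨i, rfl⟩
    rw [← hS] at hi
    rcases hi with hi | hi
    · rw [hi]; exact Set.infinite_univ
    · exact hi.2
  obtain ⟨N, hN, hinf, hres, hid⟩ := FoxCalculus.exists_normal_identifying
    (FoxCalculus.freeGroup (ZMod 2) (Fin 3)) (by simp) S hSinf
  refine ⟨F ⧸ N, inferInstance, hinf, hres, inferInstance, fun n x _ W hW hce => ?_⟩
  have hlift : ∀ w : FreeGroup (Fin n),
      FreeGroup.lift x w = (FreeGroup.lift (fun i => (x i).out) w : F) := by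
    intro w
    have : FreeGroup.lift x =
        (QuotientGroup.mk' N).comp (FreeGroup.lift fun i => (x i).out) := by
      ext i
      simp
    rw [this]
    rfl
  -- If the lifted tuple is injective on `W`, the image of `W` is infinite and is one of the sets `S
  -- i`. Otherwise two elements of `W` already agree in `F`.
  by_cases hinj : Set.InjOn (FreeGroup.lift fun i => (x i).out) W
  · have hmem : (FreeGroup.lift fun i => (x i).out) '' W ∈ Set.range S := by
      rw [← hS]
      exact Or.inr ⟨⟨n, _, W, hce, rfl⟩, hW.image hinj⟩
    obtain ⟨i, hi⟩ := hmem
    obtain ⟨u, hu, v, hv, huv, h⟩ := hid i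
    rw [hi] at hu hv
    obtain ⟨u, hu, rfl⟩ := hu
    obtain ⟨v, hv, rfl⟩ := hv
    exact ⟨u, hu, v, hv, fun e => huv (e ▸ rfl), by rw [hlift, hlift, h]⟩
  · simp only [Set.InjOn, not_forall] at hinj
    obtain ⟨u, hu, v, hv, h, huv⟩ := hinj
    exact ⟨u, hu, v, hv, huv, by rw [hlift, hlift, h]⟩
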